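/- Let $\mathbb{F}_q$ be the finite field with $q$ elements, and let $\mathcal{C}\subseteq\mathbb{F}_q^n$ be an $[n,k]$ linear code, i.e. a $k$-dimensional subspace. Let $\mathcal{C}^{\perp}$ be its dual with respect to the Euclidean inner product $\langle u,v\rangle=\sum_i u_iv_i$, let $\mathrm{Hull}(\mathcal{C})=\mathcal{C}\cap\mathcal{C}^{\perp}$, and put $\ell=\dim\mathrm{Hull}(\mathcal{C})$. For $n'\ge n$, an $[n',k]$ code $\widetilde{\mathcal{C}}$ over $\mathbb{F}_q$ is a *$t$-dimensional (Euclidean) hull embedding* of $\mathcal{C}$ if $\dim\mathrm{Hull}(\widetilde{\mathcal{C}})=t$ and $\mathcal{C}$ is obtained by puncturing $\widetilde{\mathcal{C}}$ on some set $S$ of coordinates (deleting the coordinates in $S$ from all codewords); it is *shortest* if its length $n'$ is minimal among all $t$-dimensional hull embeddings of $\mathcal{C}$. Let $G$ be a generator matrix of $\mathcal{C}$ (a $k\times n$ matrix whose rows form a basis of $\mathcal{C}$) and $r=\operatorname{rank}(GG^T)$. Square matrices $A,B$ are congruent, $A\simeq B$, if $PAP^T=B$ for some invertible $P$; a square matrix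 $A=[a_{ij}]$ is alternating if $a_{ii}=0$ and $a_{ij}=-a_{ji}$ for all $i,j$. If $q$ is odd, $\mathcal{C}$ is of type $(\mathrm{E}_{o,s})$ if $-GG^T\simeq\mathrm{diag}(I_r,O)$, and of type $(\mathrm{E}_{o,ns})$ if $r\geq 1$ and $-GG^T\simeq\mathrm{diag}(I_{r-1},z,O)$ for some non-square $z\in\mathbb{F}_q^*$. If $q=2^m$, $\mathcal{C}$ is of type $(\mathrm{E}_{e,a})$ if $GG^T$ is alternating, and of type $(\mathrm{E}_{e,na})$ otherwise. (The type does not depend on the choice of $G$.) **Theorem.** Let $\ell<t\le k$. Then $t$-dimensional Euclidean hull embeddings of $\mathcal{C}$ exist, and the length of the shortest ones is $n+s$, where: i) if $q$ is odd, $$s=\begin{cases}t-\ell, & \mathcal{C}\text{ of type }(\mathrm{E}_{o,s}),\\ t-\ell, & \mathcal{C}\text{ of type }(\mathrm{E}_{o,ns})\text{ and }t\le k-1,\\ k-\ell+1, & \mathcal{C}\text{ of type }(\mathrm{E}_{o,ns})\text{ and }t=k;\end{cases}$$ ii) if $q=2^m$, $$s=\begin{cases}t-\ell, & \mathcal{C}\text{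 of type }(\mathrm{E}_{e,na}),\\ t-\ell+1, & \mathcal{C}\text{ of type }(\mathrm{E}_{e,a}).\end{cases}$$ -/

import Mathlib

namespace HullEmbedding

open Matrix

/-- The Euclidean dual of a linear code `C ⊆ F ^ n`. -/
def dual {F : Type*} [Field F] {n : ℕ} (C : Submodule F (Fin n → F)) :
    Submodule F (Fin n → F) where
  carrier := {v | ∀ u ∈ C, u ⬝ᵥ v = 0}
  add_mem' := fun {a b} ha hb u hu => by
    rw [dotProduct_add, ha u hu, hb u hu, add_zero]
  zero_mem' := fun u _ => dotProduct_zero u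
  smul_mem' := fun c v hv u hu => by
    rw [dotProduct_smul, hv u hu, smul_zero]

/-- The Euclidean hull of a linear code. -/
def hull {F : Type*} [Field F] {n : ℕ} (C : Submodule F (Fin n → F)) :
    Submodule F (Fin n → F) :=
  C ⊓ dual C

/-- The code of length `n` obtained from a code of length `n'` by puncturing it on the coordinate
set `S`, i.e. by deleting from every codeword the coordinates in `S` and keeping the other `n`
coordinates in their order. -/
def puncture {F : Type*} [Field F] {n n' : ℕ} (C : Submodule F (Fin n' → F))
    (S : Finset (Fin n')) (hS : Sᶜ.card = n) : Submodule F (Fin n → F) :=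
  C.map (LinearMap.funLeft F F (Sᶜ.orderEmbOfFin hS))

/-- The code `C'` of length `n'` is a `t`-dimensional Euclidean hull embedding of the code `C` of
length `n`. -/
def IsHullEmbedding {F : Type*} [Field F] {n n' : ℕ} (t : ℕ) (C : Submodule F (Fin n → F))
    (C' : Submodule F (Fin n' → F)) : Prop :=
  n ≤ n' ∧
  Module.finrank F C' = Module.finrank F C ∧
  Module.finrank F (hull C') = t ∧
  ∃ (S : Finset (Fin n')) (hS : Sᶜ.card = n), puncture C' S hS = C

/-- `N` is the length of the shortest `t`-dimensional Euclidean hull embeddings of `C`: such an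
embedding of length `N` exists, and none is shorter. -/
def IsShortestLength {F : Type*} [Field F] {n : ℕ} (t : ℕ) (C : Submodule F (Fin n → F))
    (N : ℕ) : Prop :=
  IsLeast {n' : ℕ | ∃ C' : Submodule F (Fin n' → F), IsHullEmbedding t C C'} N

/-- `G` is a generator matrix of `C`: its rows form a basis of `C`. -/
def IsGeneratorMatrix {F : Type*} [Field F] {n k : ℕ} (G : Matrix (Fin k) (Fin n) F)
    (C : Submodule F (Fin n → F)) : Prop :=
  LinearIndependent F G.row ∧ Submodule.span F (Set.range G.row) = C

/-- Congruence of square matrices. -/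
def Congruent {F : Type*} [Field F] {k : ℕ} (A B : Matrix (Fin k) (Fin k) F) : Prop :=
  ∃ P : Matrix (Fin k) (Fin k) F, IsUnit P ∧ P * A * Pᵀ = B

/-- Alternating square matrices. -/
def IsAlternating {F : Type*} [Field F] {k : ℕ} (A : Matrix (Fin k) (Fin k) F) : Prop :=
  (∀ i, A i i = 0) ∧ ∀ i j, A i j = -A j i

/-- The `k × k` matrix `diag(1, …, 1, 0, …, 0)` with `r` ones (`r ≤ k`). -/
def squareForm (F : Type*) [Field F] (k r : ℕ) : Matrix (Fin k) (Fin k) F :=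
  Matrix.diagonal fun i => if (i : ℕ) < r then 1 else 0

/-- The `k × k` matrix `diag(1, …, 1, z, 0, …, 0)` with `r - 1` ones (`1 ≤ r ≤ k`). -/
def nonsquareForm {F : Type*} [Field F] (k r : ℕ) (z : F) : Matrix (Fin k) (Fin k) F :=
  Matrix.diagonal fun i => if (i : ℕ) + 1 < r then 1 else if (i : ℕ) + 1 = r then z else 0

/-- Type `E_{o,s}` (used for `q` odd): `-GGᵀ` is congruent to `diag(1, …, 1, 0, …, 0)` for a
generator matrix `G`. The congruence class of `GGᵀ` does not depend on the choice of `G`. -/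
def TypeOddSquare {F : Type*} [Field F] {n : ℕ} (C : Submodule F (Fin n → F)) : Prop :=
  ∃ G : Matrix (Fin (Module.finrank F C)) (Fin n) F, IsGeneratorMatrix G C ∧
    Congruent (-(G * Gᵀ)) (squareForm F (Module.finrank F C) (G * Gᵀ).rank)

/-- Type `E_{o,ns}` (used for `q` odd): `-GGᵀ` is congruent to `diag(1, …, 1, z, 0, …, 0)` with
`z` a non-square, for a generator matrix `G`. -/
def TypeOddNonsquare {F : Type*} [Field F] {n : ℕ} (C : Submodule F (Fin n → F)) : Prop :=
  ∃ G : Matrix (Fin (Module.finrank F C)) (Fin n) F, IsGeneratorMatrix G C ∧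
    1 ≤ (G * Gᵀ).rank ∧ ∃ z : F, z ≠ 0 ∧ ¬ IsSquare z ∧
      Congruent (-(G * Gᵀ)) (nonsquareForm (Module.finrank F C) (G * Gᵀ).rank z)

/-- Type `E_{e,a}` (used for `q` even): `GGᵀ` is alternating for a generator matrix `G`. -/
def TypeEvenAlternating {F : Type*} [Field F] {n : ℕ} (C : Submodule F (Fin n → F)) : Prop :=
  ∃ G : Matrix (Fin (Module.finrank F C)) (Fin n) F, IsGeneratorMatrix G C ∧
    IsAlternating (G * Gᵀ)

/-- Type `E_{e,na}` (used for `q` even): `GGᵀ` is not alternating for a generator matrix `G`. -/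
def TypeEvenNonalternating {F : Type*} [Field F] {n : ℕ} (C : Submodule F (Fin n → F)) : Prop :=
  ∃ G : Matrix (Fin (Module.finrank F C)) (Fin n) F, IsGeneratorMatrix G C ∧
    ¬ IsAlternating (G * Gᵀ)

end HullEmbedding

namespace HullEmbedding

open Matrix Module

/-! ### Hulls and embeddings in terms of Gram matrices -/

section Gram

variable {F : Type*} [Field F]

/-! Let `A = G * Gᵀ`. The hull has dimension `k - rank A`, and an embedding appends `s` columns `X`
to `G`, up to their position, turning the Gram matrix into `A + X * Xᵀ`. So one seeks the least `s`
for which some `X` lowers the rank by exactly `t - ℓ`. Since `s` columns lower it by at most `s`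
(`rank_le_rank_add`), `s ≥ t - ℓ`; the question is when this is attained.

For odd `q`, diagonalise `-A` and cancel entries equal to 1 with unit columns. Only cancelling the
non-square `z` fails: a determinant shows that `r` columns cannot do it, while `z = a² + b²` lets `r
+ 1` suffice.

For even `q`, if `y ⬝ᵥ A *ᵥ y = 1`, the column `A *ᵥ y` lowers the rank by one. A suitable `y` keeps
the form non-alternating, so this iterates. An alternating form admits no such `y`: one column is
spent making it non-alternating, and that one is unavoidable. -/

theorem rank_add_finrank_ker {k m : ℕ} (A : Matrix (Fin m) (Fin k) F) :
    A.rank + finrank F (LinearMap.ker A.mulVecLin) = k := by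
  rw [Matrix.rank, LinearMap.finrank_range_add_finrank_ker, finrank_fin_fun]

theorem eq_zero_of_rank_eq_zero {k m : ℕ} {A : Matrix (Fin m) (Fin k) F} (hA : A.rank = 0) :
    A = 0 := by
  refine Matrix.ext_of_mulVec_single fun i => ?_
  have := LinearMap.range_eq_bot.1 (Submodule.finrank_eq_zero.1 hA)
  rw [← mulVecLin_apply, this, LinearMap.zero_apply, zero_mulVec]

/-- The injection `x ↦ Gᵀ *ᵥ x` has image `C`, and `Gᵀ *ᵥ x` is orthogonal to every row of `G`
exactly when `x` lies in the kernel of `G * Gᵀ`. -/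
theorem finrank_hull_add_rank {k n : ℕ} {C : Submodule F (Fin n → F)}
    {G : Matrix (Fin k) (Fin n) F} (hG : IsGeneratorMatrix G C) :
    finrank F (hull C) + (G * Gᵀ).rank = k := by
  have hinj : Function.Injective Gᵀ.mulVecLin := by
    have : Function.Injective Gᵀ.mulVec := Matrix.mulVec_injective_iff.2 hG.1
    exact this
  have hrange : LinearMap.range Gᵀ.mulVecLin = C := by
    rw [Matrix.range_mulVecLin]; exact hG.2
  have hhull : hull C = (LinearMap.ker (G * Gᵀ).mulVecLin).map Gᵀ.mulVecLin := by
    ext v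
    constructor
    · rintro ⟨hv, hd⟩
      rw [SetLike.mem_coe, ← hrange] at hv
      obtain ⟨x, rfl⟩ := hv
      refine ⟨x, ?_, rfl⟩
      rw [SetLike.mem_coe, LinearMap.mem_ker, mulVecLin_apply, ← mulVec_mulVec]
      funext i
      exact hd _ (hG.2 ▸ Submodule.subset_span ⟨i, rfl⟩)
    · rintro ⟨x, hx, rfl⟩
      refine ⟨hrange ▸ ⟨x, rfl⟩, ?_⟩
      rw [SetLike.mem_coe, LinearMap.mem_ker, mulVecLin_apply, ← mulVec_mulVec] at hx
      intro u hu
      rw [← hrange] at hu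
      obtain ⟨w, rfl⟩ := hu
      rw [mulVecLin_apply, mulVecLin_apply, mulVec_transpose, ← dotProduct_mulVec, hx,
        dotProduct_zero]
  rw [hhull, ← (Submodule.equivMapOfInjective _ hinj _).finrank_eq, add_comm, rank_add_finrank_ker]

theorem sum_orderEmbOfFin {m s : ℕ} {M : Type*} [AddCommMonoid M] (S : Finset (Fin m))
    (hS : S.card = s) (f : Fin m → M) :
    ∑ j, f (S.orderEmbOfFin hS j) = ∑ x ∈ S, f x := by
  conv_rhs => rw [← S.map_orderEmbOfFin_univ hS]
  rw [Finset.sum_map]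
  rfl

/-- Lifting the rows of `G` through the puncturing gives a generator matrix of `C'`, because the
dimensions agree; its columns on `S` form `X`. The Gram matrix ignores column order, so for the
converse `X` may be appended at the end. -/
theorem exists_isHullEmbedding_iff {k n n' t : ℕ} {C : Submodule F (Fin n → F)}
    {G : Matrix (Fin k) (Fin n) F} (hG : IsGeneratorMatrix G C) :
    (∃ C' : Submodule F (Fin n' → F), IsHullEmbedding t C C') ↔
      ∃ s, n' = n + s ∧ ∃ X : Matrix (Fin k) (Fin s) F, t + (G * Gᵀ + X * Xᵀ).rank = k := by
  have hCk : finrank F C = k := by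
    rw [← hG.2, finrank_span_eq_card hG.1, Fintype.card_fin]
  constructor
  · rintro ⟨C', -, hdim, ht, S, hS, hp⟩
    have hmem : ∀ i, ∃ g ∈ C', LinearMap.funLeft F F (Sᶜ.orderEmbOfFin hS) g = G i := by
      intro i
      have : G i ∈ puncture C' S hS := by
        rw [hp, ← hG.2]; exact Submodule.subset_span ⟨i, rfl⟩
      exact this
    choose g hgC hg using hmem
    have hgen : IsGeneratorMatrix (Matrix.of g) C' := by
      have hli : LinearIndependent F (Matrix.of g).row := by
        refine LinearIndependent.of_comp (LinearMap.funLeft F F (Sᶜ.orderEmbOfFin hS)) ?_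
        convert hG.1 using 1
        funext i
        exact hg i
      refine ⟨hli, Submodule.eq_of_le_of_finrank_eq ?_ ?_⟩
      · rw [Submodule.span_le]
        rintro _ ⟨i, rfl⟩
        exact hgC i
      · rw [finrank_span_eq_card hli, Fintype.card_fin, hdim, hCk]
    have hcard : n' = n + S.card := by
      have := S.card_add_card_compl
      rw [Fintype.card_fin] at this
      omega
    refine ⟨S.card, hcard, Matrix.of fun i j => g i (S.orderEmbOfFin rfl j), ?_⟩
    refine Eq.trans ?_ (finrank_hull_add_rank hgen)
    rw [ht]
    congr 2
    ext i j
    simp only [Matrix.add_apply, mul_apply, transpose_apply, of_apply]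
    rw [sum_orderEmbOfFin S rfl (fun x => g i x * g j x), ← Finset.sum_compl_add_sum S,
      ← sum_orderEmbOfFin _ hS]
    congr 1
    refine Finset.sum_congr rfl fun x _ => ?_
    rw [← hg i, ← hg j]
    rfl
  · rintro ⟨s, rfl, X, hX⟩
    let g : Matrix (Fin k) (Fin (n + s)) F := Matrix.of fun i => Fin.append (G i) (X i)
    have hfun : ∀ i, LinearMap.funLeft F F (Fin.castAdd s) (g i) = G i := by
      intro i
      funext j
      simp [g, LinearMap.funLeft_apply]
    have hli : LinearIndependent F g.row := by
      refine LinearIndependent.of_comp (LinearMap.funLeft F F (Fin.castAdd s)) ?_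
      convert hG.1 using 1
      funext i
      exact hfun i
    have hgen : IsGeneratorMatrix g (Submodule.span F (Set.range g.row)) := ⟨hli, rfl⟩
    have hgram : g * gᵀ = G * Gᵀ + X * Xᵀ := by
      ext i j
      simp [g, mul_apply, Fin.sum_univ_add]
    have hcompl : (Finset.univ.map (Fin.natAddEmb n (m := s)))ᶜ
        = Finset.univ.map (Fin.castAddEmb s (n := n)) := by
      ext x
      refine Fin.addCases (fun i => ?_) (fun i => ?_) x
      · simp [Fin.ext_iff]
        omega
      · simp [Fin.ext_iff]
        intro a
        omega
    have hS : ((Finset.univ.map (Fin.natAddEmb n (m := s)))ᶜ).card = n := by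
      rw [hcompl]; simp
    refine ⟨Submodule.span F (Set.range g.row), Nat.le_add_right n s, ?_, ?_,
      Finset.univ.map (Fin.natAddEmb n (m := s)), hS, ?_⟩
    · rw [hCk, finrank_span_eq_card hli, Fintype.card_fin]
    · have := finrank_hull_add_rank hgen
      rw [hgram] at this
      omega
    · have hemb : ⇑((Finset.univ.map (Fin.natAddEmb n (m := s)))ᶜ.orderEmbOfFin hS)
          = Fin.castAdd s := by
        refine (Finset.orderEmbOfFin_unique hS (fun x => ?_) (Fin.strictMono_castAdd s)).symm
        rw [hcompl]
        simp
      rw [puncture, hemb, Submodule.map_span, ← Set.range_comp, ← hG.2]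
      congr 2
      funext i
      exact hfun i

theorem isShortestLength_iff {k n t s : ℕ} {C : Submodule F (Fin n → F)}
    {G : Matrix (Fin k) (Fin n) F} (hG : IsGeneratorMatrix G C) :
    IsShortestLength t C (n + s) ↔
      (∃ X : Matrix (Fin k) (Fin s) F, t + (G * Gᵀ + X * Xᵀ).rank = k) ∧
      ∀ s' (X : Matrix (Fin k) (Fin s') F), t + (G * Gᵀ + X * Xᵀ).rank = k → s ≤ s' := by
  simp only [IsShortestLength, IsLeast, mem_lowerBounds, Set.mem_ofPred_eq,
    exists_isHullEmbedding_iff hG]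
  constructor
  · rintro ⟨⟨s₁, h₁, hX⟩, hmin⟩
    obtain rfl : s = s₁ := by omega
    exact ⟨hX, fun s' X h => by have := hmin (n + s') ⟨s', rfl, X, h⟩; omega⟩
  · rintro ⟨hX, hmin⟩
    refine ⟨⟨s, rfl, hX⟩, ?_⟩
    rintro _ ⟨s', rfl, X, h⟩
    have := hmin s' X h
    omega

end Gram

/-! ### Rank under adding `X * Xᵀ` -/

section Perturbation

variable {F : Type*} [Field F] {k : ℕ}

theorem mulVec_add_mul_transpose {s : ℕ} (A : Matrix (Fin k) (Fin k) F)
    (X : Matrix (Fin k) (Fin s) F) (v : Fin k → F) :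
    (A + X * Xᵀ) *ᵥ v = A *ᵥ v + X *ᵥ (Xᵀ *ᵥ v) := by
  rw [add_mulVec, mulVec_mulVec]

theorem ker_inf_ker_le {s : ℕ} (A : Matrix (Fin k) (Fin k) F) (X : Matrix (Fin k) (Fin s) F) :
    LinearMap.ker (A + X * Xᵀ).mulVecLin ⊓ LinearMap.ker Xᵀ.mulVecLin
      ≤ LinearMap.ker A.mulVecLin := by
  rintro v ⟨h₁, h₂⟩
  simp only [SetLike.mem_coe, LinearMap.mem_ker, mulVecLin_apply] at h₁ h₂ ⊢
  rw [mulVec_add_mul_transpose, h₂, mulVec_zero, add_zero] at h₁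
  exact h₁

/-- Inside the kernel of `A + X * Xᵀ`, the `s` linear conditions `Xᵀ *ᵥ v = 0` cut out a subspace of
the kernel of `A`. -/
theorem rank_le_rank_add {s : ℕ} (A : Matrix (Fin k) (Fin k) F) (X : Matrix (Fin k) (Fin s) F) :
    A.rank ≤ (A + X * Xᵀ).rank + s := by
  have h₁ := Submodule.finrank_mono (ker_inf_ker_le A X)
  have h₂ := Submodule.finrank_sup_add_finrank_inf_eq
    (LinearMap.ker (A + X * Xᵀ).mulVecLin) (LinearMap.ker Xᵀ.mulVecLin)
  have h₃ := Submodule.finrank_le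
    (LinearMap.ker (A + X * Xᵀ).mulVecLin ⊔ LinearMap.ker Xᵀ.mulVecLin)
  have h₄ := rank_add_finrank_ker A
  have h₅ := rank_add_finrank_ker (A + X * Xᵀ)
  have h₆ := rank_add_finrank_ker Xᵀ
  have h₇ : Xᵀ.rank ≤ s := Xᵀ.rank_le_height
  rw [finrank_fin_fun] at h₃
  omega

theorem exists_append_column {s : ℕ} (X : Matrix (Fin k) (Fin s) F) (x : Fin k → F) :
    ∃ Y : Matrix (Fin k) (Fin (s + 1)) F, Y * Yᵀ = X * Xᵀ + vecMulVec x x := by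
  refine ⟨Matrix.of fun i => Fin.cons (x i) (X i), ?_⟩
  ext i j
  simp [mul_apply, Fin.sum_univ_succ, vecMulVec_apply, add_comm]

theorem exists_mul_transpose_eq_vecMulVec (x : Fin k → F) :
    ∃ X : Matrix (Fin k) (Fin 1) F, X * Xᵀ = vecMulVec x x := by
  obtain ⟨X, hX⟩ := exists_append_column (0 : Matrix (Fin k) (Fin 0) F) x
  exact ⟨X, by simpa using hX⟩

theorem rank_le_rank_add_vecMulVec (A : Matrix (Fin k) (Fin k) F) (x : Fin k → F) :
    A.rank ≤ (A + vecMulVec x x).rank + 1 := by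
  obtain ⟨X, hX⟩ := exists_mul_transpose_eq_vecMulVec x
  rw [← hX]
  exact rank_le_rank_add A X

theorem exists_rank_add_of_congruent {s ρ : ℕ} {A D P : Matrix (Fin k) (Fin k) F}
    (hP : IsUnit P) (h : P * A * Pᵀ = D) {Y : Matrix (Fin k) (Fin s) F}
    (hY : (D + Y * Yᵀ).rank = ρ) :
    ∃ X : Matrix (Fin k) (Fin s) F, (A + X * Xᵀ).rank = ρ := by
  have hdet : IsUnit P.det := (isUnit_iff_isUnit_det P).1 hP
  refine ⟨P⁻¹ * Y, ?_⟩
  have hPY : P * (P⁻¹ * Y) = Y := by rw [← Matrix.mul_assoc, mul_nonsing_inv _ hdet, Matrix.one_mul]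
  have key : P * (A + P⁻¹ * Y * (P⁻¹ * Y)ᵀ) * Pᵀ = D + Y * Yᵀ := by
    rw [Matrix.mul_add, Matrix.add_mul, h, ← Matrix.mul_assoc, hPY, Matrix.mul_assoc,
      ← transpose_mul, hPY]
  rw [← hY, ← key, rank_mul_eq_left_of_isUnit_det _ _ (by rwa [det_transpose]),
    rank_mul_eq_right_of_isUnit_det _ _ hdet]

theorem exists_mul_transpose_eq_diagonal (s : ℕ) :
    ∃ Y : Matrix (Fin k) (Fin s) F,
      Y * Yᵀ = diagonal fun i : Fin k => if (i : ℕ) < s then 1 else 0 := by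
  refine ⟨Matrix.of fun i j => if (i : ℕ) = j then 1 else 0, ?_⟩
  ext i j
  simp only [mul_apply, transpose_apply, of_apply, diagonal_apply]
  by_cases hi : (i : ℕ) < s
  · rw [Finset.sum_eq_single (⟨i, hi⟩ : Fin s)]
    · simp [hi, Fin.ext_iff, eq_comm]
    · intro b _ hb
      rw [if_neg (fun h => hb (Fin.ext h.symm)), zero_mul]
    · simp
  · rw [Finset.sum_eq_zero]
    · simp [hi]
    · intro x _
      rw [if_neg (by omega), zero_mul]

theorem exists_rank_add_eq_of_diagonal {s r : ℕ} {A : Matrix (Fin k) (Fin k) F}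
    {d : Fin k → F} (hA : Congruent (-A) (diagonal d)) (hr : A.rank = r)
    (h₁ : ∀ i : Fin k, (i : ℕ) < s → d i = 1) (h₀ : ∀ i : Fin k, r ≤ (i : ℕ) → d i = 0) :
    ∃ X : Matrix (Fin k) (Fin s) F, (A + X * Xᵀ).rank = r - s := by
  classical
  obtain ⟨P, hP, hPA⟩ := hA
  have hPA' : P * A * Pᵀ = -diagonal d := by
    rw [← hPA, Matrix.mul_neg, Matrix.neg_mul, neg_neg]
  obtain ⟨Y, hY⟩ := exists_mul_transpose_eq_diagonal (F := F) (k := k) s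
  obtain ⟨X, hX⟩ := exists_rank_add_of_congruent hP hPA' (Y := Y) rfl
  refine ⟨X, le_antisymm ?_ ?_⟩
  -- After the first `s` ones cancel, nonzero diagonal entries can only sit at indices in `[s, r)`.
  · rw [hX, hY, diagonal_neg, diagonal_add, rank_diagonal, Fintype.card_subtype,
      ← Nat.card_Ico s r, ← Finset.card_map Fin.valEmbedding]
    refine Finset.card_le_card fun i hi => ?_
    simp only [Finset.mem_map, Finset.mem_filter, Finset.mem_univ, true_and] at hi
    obtain ⟨a, ha, rfl⟩ := hi
    rw [Finset.mem_Ico]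
    by_contra hcon
    rw [Fin.valEmbedding_apply, not_and_or, not_le, not_lt] at hcon
    apply ha
    by_cases has : (a : ℕ) < s
    · simp [has, h₁ a has]
    · simp [has, h₀ a (hcon.resolve_left has)]
  · have := rank_le_rank_add A X
    omega

end Perturbation

/-! ### Odd characteristic: the non-square obstruction -/

section Odd

variable {F : Type*} [Field F] {k : ℕ}

/-- The top `r` rows of `P * X` form a square matrix `Y` with `Y * Yᵀ = diag(1, …, 1, z)`, so `z =
(det Y)²`. -/
theorem isSquare_of_add_mul_transpose_eq_zero {r : ℕ} {A : Matrix (Fin k) (Fin k) F} {z : F}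
    (hr : 1 ≤ r) (hrk : r ≤ k) (hA : Congruent (-A) (nonsquareForm k r z))
    {X : Matrix (Fin k) (Fin r) F} (hX : A + X * Xᵀ = 0) : IsSquare z := by
  obtain ⟨P, -, hPA⟩ := hA
  have hPX : P * X * (P * X)ᵀ = nonsquareForm k r z := by
    rw [← hPA, neg_eq_of_add_eq_zero_right hX, transpose_mul]
    simp only [Matrix.mul_assoc]
  let Y : Matrix (Fin r) (Fin r) F := (P * X).submatrix (Fin.castLE hrk) id
  have hY : Y * Yᵀ = diagonal fun i : Fin r => if (i : ℕ) + 1 < r then 1 else z := by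
    have h := congrArg (fun M => M.submatrix (Fin.castLE hrk) (Fin.castLE hrk)) hPX
    ext i j
    have hij := congrFun (congrFun h i) j
    simp only [nonsquareForm, submatrix_apply, diagonal_apply, Fin.val_castLE,
      (Fin.castLE_injective hrk).eq_iff] at hij
    change (P * X * (P * X)ᵀ) (Fin.castLE hrk i) (Fin.castLE hrk j) = _
    rw [hij, diagonal_apply]
    have := i.2
    split_ifs <;> first | rfl | omega
  refine ⟨Y.det, ?_⟩
  have hdet := congrArg Matrix.det hY
  rw [det_mul, det_transpose, det_diagonal] at hdet
  rw [hdet]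
  obtain ⟨r, rfl⟩ : ∃ r', r = r' + 1 := ⟨r - 1, by omega⟩
  simp [Fin.prod_univ_castSucc]

theorem exists_sq_add_sq_eq [Fintype F] (hF : Odd (Fintype.card F)) (z : F) :
    ∃ a b : F, a * a + b * b = z := by
  obtain ⟨a, b, hab⟩ := FiniteField.exists_root_sum_quadratic
    (f := (Polynomial.X ^ 2 : Polynomial F)) (g := Polynomial.X ^ 2 - Polynomial.C z)
    (by simp) (Polynomial.degree_X_pow_sub_C (by norm_num) z) (Nat.odd_iff.1 hF)
  refine ⟨a, b, ?_⟩
  rw [← sub_eq_zero]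
  simpa [pow_two, add_sub_assoc] using hab

theorem exists_rank_add_eq_zero_of_nonsquareForm [Fintype F] (hF : Odd (Fintype.card F)) {r : ℕ}
    {A : Matrix (Fin k) (Fin k) F} {z : F} (hr : 1 ≤ r) (hrk : r ≤ k)
    (hA : Congruent (-A) (nonsquareForm k r z)) :
    ∃ X : Matrix (Fin k) (Fin (r + 1)) F, (A + X * Xᵀ).rank = 0 := by
  obtain ⟨P, hP, hPA⟩ := hA
  have hPA' : P * A * Pᵀ = -nonsquareForm k r z := by
    rw [← hPA, Matrix.mul_neg, Matrix.neg_mul, neg_neg]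
  obtain ⟨r, rfl⟩ : ∃ r', r = r' + 1 := ⟨r - 1, by omega⟩
  obtain ⟨a, b, hab⟩ := exists_sq_add_sq_eq hF z
  obtain ⟨Y₀, hY₀⟩ := exists_mul_transpose_eq_diagonal (F := F) (k := k) r
  -- With `r` now the index of the entry `z`, two columns supported there contribute `a² + b² = z`.
  obtain ⟨Y₁, hY₁⟩ := exists_append_column Y₀ (Pi.single (⟨r, hrk⟩ : Fin k) a)
  obtain ⟨Y₂, hY₂⟩ := exists_append_column Y₁ (Pi.single (⟨r, hrk⟩ : Fin k) b)
  refine exists_rank_add_of_congruent hP hPA' (Y := Y₂) ?_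
  have hzero : -nonsquareForm k (r + 1) z + Y₂ * Y₂ᵀ = 0 := by
    rw [neg_add_eq_zero, hY₂, hY₁, hY₀]
    ext i j
    simp only [nonsquareForm, Matrix.add_apply, diagonal_apply, vecMulVec_apply, Pi.single_apply,
      Fin.ext_iff, add_lt_add_iff_right, add_left_inj]
    by_cases hij : (i : ℕ) = j
    · by_cases hi : (i : ℕ) = r
      · simp [← hij, hi, hab]
      · simp [← hij, hi]
    · by_cases hi : (i : ℕ) = r
      · have : (j : ℕ) ≠ r := by omega
        simp [hij, this]
      · simp [hij, hi]
  rw [hzero, rank_zero]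

end Odd

/-! ### Characteristic two: alternating and non-alternating forms -/

section CharTwo

variable {F : Type*} [Field F] {k : ℕ}

theorem dotProduct_mulVec_comm {A : Matrix (Fin k) (Fin k) F} (hA : Aᵀ = A) (v w : Fin k → F) :
    v ⬝ᵥ A *ᵥ w = w ⬝ᵥ A *ᵥ v := by
  rw [dotProduct_mulVec, ← mulVec_transpose, hA, dotProduct_comm]

theorem add_vecMulVec_mulVec (A : Matrix (Fin k) (Fin k) F) (x v : Fin k → F) :
    (A + vecMulVec x x) *ᵥ v = A *ᵥ v + (x ⬝ᵥ v) • x := by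
  rw [add_mulVec, vecMulVec_mulVec]
  simp

theorem dotProduct_add_vecMulVec_mulVec (A : Matrix (Fin k) (Fin k) F) (x v : Fin k → F) :
    v ⬝ᵥ (A + vecMulVec x x) *ᵥ v = v ⬝ᵥ A *ᵥ v + (x ⬝ᵥ v) ^ 2 := by
  rw [add_vecMulVec_mulVec, dotProduct_add, dotProduct_smul, dotProduct_comm v x, smul_eq_mul,
    pow_two]

theorem transpose_add_vecMulVec {A : Matrix (Fin k) (Fin k) F} (hA : Aᵀ = A) (x : Fin k → F) :
    (A + vecMulVec x x)ᵀ = A + vecMulVec x x := by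
  rw [transpose_add, hA, transpose_vecMulVec]

/-- The new matrix sends `v` to `A *ᵥ v + (y ⬝ᵥ A *ᵥ v) • A *ᵥ y`: it still kills the kernel of `A`,
and now also `y`, which lies outside it. -/
theorem rank_add_vecMulVec_of_dotProduct_eq_neg_one {A : Matrix (Fin k) (Fin k) F} (hA : Aᵀ = A)
    {y : Fin k → F} (hy : y ⬝ᵥ A *ᵥ y = -1) :
    (A + vecMulVec (A *ᵥ y) (A *ᵥ y)).rank = A.rank - 1 := by
  have h₁ := rank_le_rank_add_vecMulVec A (A *ᵥ y)
  have hlt : LinearMap.ker A.mulVecLin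
      < LinearMap.ker (A + vecMulVec (A *ᵥ y) (A *ᵥ y)).mulVecLin := by
    refine lt_of_le_of_ne (fun v hv => ?_) fun heq => ?_
    · simp only [LinearMap.mem_ker, mulVecLin_apply] at hv ⊢
      rw [add_vecMulVec_mulVec, dotProduct_comm, dotProduct_mulVec_comm hA, hv]
      simp
    · have hyk : y ∈ LinearMap.ker (A + vecMulVec (A *ᵥ y) (A *ᵥ y)).mulVecLin := by
        rw [LinearMap.mem_ker, mulVecLin_apply, add_vecMulVec_mulVec, dotProduct_comm, hy]
        simp
      rw [← heq, LinearMap.mem_ker, mulVecLin_apply] at hyk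
      rw [hyk, dotProduct_zero] at hy
      exact one_ne_zero (neg_eq_zero.1 hy.symm)
  have h₂ := Submodule.finrank_lt_finrank_of_lt hlt
  have h₃ := rank_add_finrank_ker A
  have h₄ := rank_add_finrank_ker (A + vecMulVec (A *ᵥ y) (A *ᵥ y))
  omega

theorem exists_dotProduct_mulVec_eq_zero {A : Matrix (Fin k) (Fin k) F} (hr : 2 ≤ A.rank)
    (a : Fin k → F) : ∃ w, a ⬝ᵥ w = 0 ∧ A *ᵥ w ≠ 0 := by
  by_contra! hcon
  have hle : LinearMap.ker (Matrix.of fun (_ : Fin 1) => a).mulVecLin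
      ≤ LinearMap.ker A.mulVecLin := by
    intro w hw
    exact hcon w (congrFun hw 0)
  have h₁ := Submodule.finrank_mono hle
  have h₂ := rank_add_finrank_ker A
  have h₃ := rank_add_finrank_ker (Matrix.of fun (_ : Fin 1) => a)
  have h₄ : (Matrix.of fun (_ : Fin 1) => a).rank ≤ 1 := rank_le_height _
  omega

/-- The second conclusion is what allows iteration. If `y` leaves an alternating form, then `v ⬝ᵥ A
*ᵥ v = (A *ᵥ y ⬝ᵥ v)²` for all `v`. Replacing `y` by `y + w`, with `w` orthogonal to `A *ᵥ y` and `A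
*ᵥ w ≠ 0`, leaves `(A *ᵥ w ⬝ᵥ v)²` instead. -/
theorem exists_rank_add_vecMulVec_eq [Finite F] [CharP F 2] {A : Matrix (Fin k) (Fin k) F}
    (hA : Aᵀ = A) (hne : ∃ v, v ⬝ᵥ A *ᵥ v ≠ 0) :
    ∃ x : Fin k → F, (A + vecMulVec x x).rank = A.rank - 1 ∧
      (2 ≤ A.rank → ∃ v, v ⬝ᵥ (A + vecMulVec x x) *ᵥ v ≠ 0) := by
  obtain ⟨y, hy⟩ : ∃ y, y ⬝ᵥ A *ᵥ y = 1 := by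
    obtain ⟨v, hv⟩ := hne
    -- Every element is a square here, so `v` can be rescaled to value 1.
    obtain ⟨b, hb⟩ := FiniteField.isSquare_of_char_two (ringChar.eq F 2) (v ⬝ᵥ A *ᵥ v)
    have hb0 : b ≠ 0 := by rintro rfl; simp [hb] at hv
    refine ⟨b⁻¹ • v, ?_⟩
    rw [mulVec_smul, dotProduct_smul, smul_dotProduct, hb, smul_eq_mul, smul_eq_mul]
    field_simp
  have hrank : ∀ u, u ⬝ᵥ A *ᵥ u = 1 → (A + vecMulVec (A *ᵥ u) (A *ᵥ u)).rank = A.rank - 1 :=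
    fun u hu => rank_add_vecMulVec_of_dotProduct_eq_neg_one hA (by rw [hu, CharTwo.neg_eq])
  by_cases hex : ∃ v, v ⬝ᵥ (A + vecMulVec (A *ᵥ y) (A *ᵥ y)) *ᵥ v ≠ 0
  · exact ⟨A *ᵥ y, hrank y hy, fun _ => hex⟩
  by_cases hr : 2 ≤ A.rank
  swap
  · exact ⟨A *ᵥ y, hrank y hy, fun h => absurd h hr⟩
  push Not at hex
  have hq : ∀ v, v ⬝ᵥ A *ᵥ v = (A *ᵥ y ⬝ᵥ v) ^ 2 := fun v => by
    have := hex v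
    rwa [dotProduct_add_vecMulVec_mulVec, CharTwo.add_eq_zero] at this
  obtain ⟨w, hw, hAw⟩ := exists_dotProduct_mulVec_eq_zero hr (A *ᵥ y)
  have hyw : y ⬝ᵥ A *ᵥ w = 0 := by rw [dotProduct_mulVec_comm hA, dotProduct_comm, hw]
  refine ⟨A *ᵥ (y + w), hrank _ ?_, fun _ => ?_⟩
  · rw [hq, dotProduct_add, hw, add_zero, ← hq, hy]
  · obtain ⟨i, hi⟩ := Function.ne_iff.1 hAw
    refine ⟨Pi.single i 1, ?_⟩
    rw [dotProduct_add_vecMulVec_mulVec, hq, mulVec_add, add_dotProduct, CharTwo.add_sq,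
      ← add_assoc, CharTwo.add_self_eq_zero, zero_add]
    simpa using hi

theorem exists_rank_add_eq_of_charTwo [Finite F] [CharP F 2] (s : ℕ) :
    ∀ {A : Matrix (Fin k) (Fin k) F}, Aᵀ = A → (∃ v, v ⬝ᵥ A *ᵥ v ≠ 0) → s ≤ A.rank →
      ∃ X : Matrix (Fin k) (Fin s) F, (A + X * Xᵀ).rank = A.rank - s := by
  induction s with
  | zero => exact fun _ _ _ => ⟨0, by simp⟩
  | succ s ih =>
    intro A hA hne hs
    obtain ⟨x, hx, hx'⟩ := exists_rank_add_vecMulVec_eq hA hne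
    obtain ⟨X, hX⟩ : ∃ X : Matrix (Fin k) (Fin s) F,
        (A + vecMulVec x x + X * Xᵀ).rank = (A + vecMulVec x x).rank - s := by
      -- The form is known to stay non-alternating only for `2 ≤ A.rank`, which `s ≥ 1` ensures; for
      -- `s = 0` nothing remains to remove.
      rcases Nat.eq_zero_or_pos s with rfl | hpos
      · exact ⟨0, by simp⟩
      · exact ih (transpose_add_vecMulVec hA x) (hx' (by omega)) (by omega)
    obtain ⟨Y, hY⟩ := exists_append_column X x
    refine ⟨Y, ?_⟩
    rw [hY, add_comm (X * Xᵀ), ← add_assoc, hX, hx]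
    omega

theorem IsAlternating.dotProduct_mulVec_self [CharP F 2] {A : Matrix (Fin k) (Fin k) F}
    (hA : IsAlternating A) (v : Fin k → F) : v ⬝ᵥ A *ᵥ v = 0 := by
  have hsum : v ⬝ᵥ A *ᵥ v = ∑ p : Fin k × Fin k, v p.1 * A p.1 p.2 * v p.2 := by
    simp [dotProduct, mulVec, Finset.mul_sum, Fintype.sum_prod_type, mul_assoc]
  rw [hsum]
  refine Finset.sum_involution (fun p _ => p.swap) ?_ ?_ (fun _ _ => Finset.mem_univ _)
    (fun p _ => Prod.swap_swap p)
  · rintro ⟨i, j⟩ -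
    simp only [Prod.swap, hA.2 j i]
    ring
  · rintro ⟨i, j⟩ - hne heq
    simp only [Prod.swap, Prod.mk.injEq] at heq
    obtain ⟨rfl, -⟩ := heq
    simp [hA.1] at hne

theorem exists_dotProduct_mulVec_self_ne_zero [CharP F 2] {A : Matrix (Fin k) (Fin k) F}
    (hA : Aᵀ = A) (hna : ¬ IsAlternating A) : ∃ v, v ⬝ᵥ A *ᵥ v ≠ 0 := by
  by_contra! hcon
  refine hna ⟨fun i => by simpa using hcon (Pi.single i 1), fun i j => ?_⟩
  rw [CharTwo.neg_eq]
  exact congrFun (congrFun hA.symm i) j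

/-- In case of equality `Xᵀ` maps the kernel of `A + X * Xᵀ` onto `F ^ s`. A kernel vector `v` with
`Xᵀ *ᵥ v` the first unit vector then gives `0 = v ⬝ᵥ A *ᵥ v + 1 = 1`. -/
theorem lt_of_rank_add_eq_of_isAlternating [CharP F 2] {s : ℕ} {A : Matrix (Fin k) (Fin k) F}
    (hA : IsAlternating A) (hs : 1 ≤ s) (X : Matrix (Fin k) (Fin s) F) :
    A.rank < (A + X * Xᵀ).rank + s := by
  refine lt_of_le_of_ne (rank_le_rank_add A X) fun heq => ?_
  let K := LinearMap.ker (A + X * Xᵀ).mulVecLin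
  let f : K →ₗ[F] (Fin s → F) := Xᵀ.mulVecLin.domRestrict K
  have hker : finrank F (LinearMap.ker f) ≤ finrank F (LinearMap.ker A.mulVecLin) := by
    rw [(Submodule.equivMapOfInjective _ K.injective_subtype (LinearMap.ker f)).finrank_eq]
    refine Submodule.finrank_mono ?_
    rintro _ ⟨v, hv, rfl⟩
    exact ker_inf_ker_le A X ⟨v.2, hv⟩
  have h₁ := rank_add_finrank_ker A
  have h₂ : (A + X * Xᵀ).rank + finrank F K = k := rank_add_finrank_ker (A + X * Xᵀ)
  have h₃ := f.finrank_range_add_finrank_ker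
  have hsurj : LinearMap.range f = ⊤ := by
    refine Submodule.eq_top_of_finrank_eq (le_antisymm (Submodule.finrank_le _) ?_)
    rw [finrank_fin_fun]
    omega
  obtain ⟨⟨v, hv⟩, hfv⟩ := LinearMap.range_eq_top.1 hsurj (Pi.single ⟨0, hs⟩ 1)
  have hfv' : Xᵀ *ᵥ v = Pi.single ⟨0, hs⟩ 1 := hfv
  have hv' : A *ᵥ v + X *ᵥ (Xᵀ *ᵥ v) = 0 := by
    rw [← mulVec_add_mul_transpose]; exact hv
  have h := congrArg (v ⬝ᵥ ·) hv'
  simp only [dotProduct_add, hA.dotProduct_mulVec_self, dotProduct_zero, zero_add] at h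
  rw [dotProduct_mulVec, ← mulVec_transpose, hfv'] at h
  simp at h

theorem exists_rank_add_eq_of_isAlternating [Finite F] [CharP F 2] {s : ℕ}
    {A : Matrix (Fin k) (Fin k) F} (hsymm : Aᵀ = A) (hA : IsAlternating A) (hs : s ≤ A.rank)
    (hpos : 1 ≤ A.rank) :
    ∃ X : Matrix (Fin k) (Fin (s + 1)) F, (A + X * Xᵀ).rank = A.rank - s := by
  obtain ⟨y, hy⟩ : ∃ y, A *ᵥ y ≠ 0 := by
    by_contra! hcon
    have : A = 0 := Matrix.ext_of_mulVec_single fun i => by rw [hcon, zero_mulVec]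
    simp [this] at hpos
  have hker : LinearMap.ker (A + vecMulVec (A *ᵥ y) (A *ᵥ y)).mulVecLin
      = LinearMap.ker A.mulVecLin := by
    ext v
    simp only [LinearMap.mem_ker, mulVecLin_apply, add_vecMulVec_mulVec]
    have hc : A *ᵥ y ⬝ᵥ v = y ⬝ᵥ A *ᵥ v := by
      rw [dotProduct_comm, dotProduct_mulVec_comm hsymm]
    constructor
    -- Pairing with `y` and using `y ⬝ᵥ A *ᵥ y = 0` gives `y ⬝ᵥ A *ᵥ v = 0`, so the extra column
    -- leaves the kernel unchanged.
    · intro h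
      have h' := congrArg (y ⬝ᵥ ·) h
      simp only [dotProduct_add, dotProduct_smul, hA.dotProduct_mulVec_self, smul_zero, add_zero,
        dotProduct_zero] at h'
      rwa [hc, h', zero_smul, add_zero] at h
    · intro h
      rw [hc, h, dotProduct_zero, zero_smul, add_zero]
  have hrank : (A + vecMulVec (A *ᵥ y) (A *ᵥ y)).rank = A.rank := by
    have h₁ := rank_add_finrank_ker A
    have h₂ := rank_add_finrank_ker (A + vecMulVec (A *ᵥ y) (A *ᵥ y))
    rw [hker] at h₂
    omega
  have hne : ∃ v, v ⬝ᵥ (A + vecMulVec (A *ᵥ y) (A *ᵥ y)) *ᵥ v ≠ 0 := by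
    obtain ⟨i, hi⟩ := Function.ne_iff.1 hy
    refine ⟨Pi.single i 1, ?_⟩
    rw [dotProduct_add_vecMulVec_mulVec, hA.dotProduct_mulVec_self, zero_add]
    simpa using hi
  obtain ⟨X, hX⟩ := exists_rank_add_eq_of_charTwo s (transpose_add_vecMulVec hsymm _) hne
    (hrank.symm ▸ hs)
  obtain ⟨Y, hY⟩ := exists_append_column X (A *ᵥ y)
  exact ⟨Y, by rw [hY, add_comm (X * Xᵀ), ← add_assoc, hX, hrank]⟩

end CharTwo

end HullEmbedding

/-! ### The theorem, type by type -/

open HullEmbedding in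
theorem mainTheorem1 {F : Type*} [Field F] [Fintype F] (q : ℕ) (hq : Fintype.card F = q)
    (n k ℓ t : ℕ) (C : Submodule F (Fin n → F))
    (hk : Module.finrank F C = k) (hℓ : Module.finrank F (HullEmbedding.hull C) = ℓ)
    (hℓt : ℓ < t) (htk : t ≤ k) :
    (Odd q →
      (HullEmbedding.TypeOddSquare C →
        HullEmbedding.IsShortestLength t C (n + (t - ℓ))) ∧
      (HullEmbedding.TypeOddNonsquare C → t ≤ k - 1 →
        HullEmbedding.IsShortestLength t C (n + (t - ℓ))) ∧
      (HullEmbedding.TypeOddNonsquare C → t = k →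
        HullEmbedding.IsShortestLength t C (n + (k - ℓ + 1)))) ∧
    (∀ m : ℕ, q = 2 ^ m →
      (HullEmbedding.TypeEvenNonalternating C →
        HullEmbedding.IsShortestLength t C (n + (t - ℓ))) ∧
      (HullEmbedding.TypeEvenAlternating C →
        HullEmbedding.IsShortestLength t C (n + (t - ℓ + 1)))) := by
  have hsymm : ∀ G : Matrix (Fin (Module.finrank F C)) (Fin n) F, (G * G.transpose).transpose
      = G * G.transpose := fun G => by
    rw [Matrix.transpose_mul, Matrix.transpose_transpose]
  refine ⟨fun hodd => ⟨?_, ?_, ?_⟩, fun m hm => ?_⟩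
  · rintro ⟨G, hG, hA⟩
    have hrank := finrank_hull_add_rank hG
    obtain ⟨X, hX⟩ := exists_rank_add_eq_of_diagonal (s := t - ℓ) hA rfl
      (fun i hi => if_pos (by omega)) (fun i hi => if_neg (by omega))
    refine (isShortestLength_iff hG).2 ⟨⟨X, by omega⟩, fun s Y hY => ?_⟩
    have := rank_le_rank_add (G * G.transpose) Y
    omega
  · rintro ⟨G, hG, hr, z, -, -, hA⟩ ht
    have hrank := finrank_hull_add_rank hG
    -- As `t ≤ k - 1`, at most `r - 1` entries need cancelling, all of them ones.
    obtain ⟨X, hX⟩ := exists_rank_add_eq_of_diagonal (s := t - ℓ) hA rfl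
      (fun i hi => if_pos (by omega))
      (fun i hi => by rw [if_neg (by omega), if_neg (by omega)])
    refine (isShortestLength_iff hG).2 ⟨⟨X, by omega⟩, fun s Y hY => ?_⟩
    have := rank_le_rank_add (G * G.transpose) Y
    omega
  · rintro ⟨G, hG, hr, z, -, hz, hA⟩ rfl
    have hrank := finrank_hull_add_rank hG
    have hrk : (G * G.transpose).rank ≤ Module.finrank F C := by omega
    obtain ⟨X, hX⟩ := exists_rank_add_eq_zero_of_nonsquareForm (hq ▸ hodd) hr hrk hA
    have hs : t - ℓ = (G * G.transpose).rank := by omega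
    rw [hs]
    refine (isShortestLength_iff hG).2 ⟨⟨X, by omega⟩, fun s Y hY => ?_⟩
    have hle := rank_le_rank_add (G * G.transpose) Y
    have hzero : (G * G.transpose + Y * Y.transpose).rank = 0 := by omega
    -- For `t = k` the sum must vanish, so `s` is at least the rank; equality would make `z` a
    -- square.
    refine Nat.succ_le_of_lt (lt_of_le_of_ne (by omega) ?_)
    rintro rfl
    exact hz (isSquare_of_add_mul_transpose_eq_zero hr hrk hA 
      (eq_zero_of_rank_eq_zero hzero))
  · have h2 : (2 : F) = 0 := by
      have hcast := Nat.cast_card_eq_zero F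
      rw [hq, hm, Nat.cast_pow] at hcast
      exact_mod_cast eq_zero_of_pow_eq_zero hcast
    have : CharP F 2 := CharTwo.of_one_ne_zero_of_two_eq_zero one_ne_zero h2
    constructor
    · rintro ⟨G, hG, hA⟩
      have hrank := finrank_hull_add_rank hG
      obtain ⟨X, hX⟩ := exists_rank_add_eq_of_charTwo (t - ℓ) (hsymm G)
        (exists_dotProduct_mulVec_self_ne_zero (hsymm G) hA) (by omega)
      refine (isShortestLength_iff hG).2 ⟨⟨X, by omega⟩, fun s Y hY => ?_⟩
      have := rank_le_rank_add (G * G.transpose) Y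
      omega
    · rintro ⟨G, hG, hA⟩
      have hrank := finrank_hull_add_rank hG
      obtain ⟨X, hX⟩ := exists_rank_add_eq_of_isAlternating (s := t - ℓ) (hsymm G) hA
        (by omega) (by omega)
      refine (isShortestLength_iff hG).2 ⟨⟨X, by omega⟩, fun s Y hY => ?_⟩
      have hle := rank_le_rank_add (G * G.transpose) Y
      have := lt_of_rank_add_eq_of_isAlternating hA (by omega) Y
      omega
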